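/- Let $TB\in\mathbb N_0$ be a total budget. A finite game form $G=\{G^{\mathcal L}\mid G^{\mathcal R}\}$ consists, recursively, of a finite (possibly empty) set $G^{\mathcal L}$ of Left options and a finite (possibly empty) set $G^{\mathcal R}$ of Right options, all of them finite game forms (of finite rank). A position is a game form together with a split of the budget: Left has $p$ and Right has $q=TB-p$, where $0\le p\le TB$, and exactly one player holds a marker; write $(G,\hat p)$ if Left holds it and $(G,p)$ if Right holds it. At each stage both players simultaneously bid amounts $\ell\in\{0,\dots,p\}$ (Left) and $r\in\{0,\dots,q\}$ (Right), and the marker holder may in addition include the marker in their bid. The higher bid wins, and the marker holder wins ties. The winner of the bid pays the amount of their bid to the opponent and moves to one of their own options; if they have no option, they lose the game. The marker passes to the opponent exactly when its holder wins the bid and either the bids are equal or the marker was included in the bid. Play continues from the resulting position. Let $o(G,\tilde p)\in\{\mathrm L,\mathrm R\}$, with $\mathrm L>\mathrm R$, be the winner (Left or Right) in a pure strategy subgame perfect equilibrium of $(G,\tilde p)$, computed by backward induction, where $\tilde p\in\{\hat 0,\dots,\widehat{TB},0,\dots,TB\}$. The outcome of $G$ is the $2(TB+1)$-tuple $$o(G)=(o(G,\widehat{TB}),\dots,o(G,\hat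 0),o(G,TB),\dots,o(G,0)).$$ A tuple $\omega\in\{\mathrm L,\mathrm R\}^{2(TB+1)}$, indexed in the same way, is called feasible if for all $0\le p<TB$ $$\omega(\hat p)\le\omega(\widehat{p+1}),\qquad \omega(p)\le\omega(p+1)\qquad\text{(monotonicity)},$$ $$\omega(\hat p)\le\omega(p+1)\qquad\text{(Marker Worth)}.$$ **Theorem (Main Theorem).** For every total budget $TB\in\mathbb N_0$, the outcome $o(G)$ of every finite game form $G$ exists and is unique, and a tuple $\omega\in\{\mathrm L,\mathrm R\}^{2(TB+1)}$ is feasible if and only if there is a finite game form $G$ with $o(G)=\omega$. -/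

import Mathlib

namespace BiddingGame

/-- The two players, Left and Right. -/
inductive Player
  | left
  | right

/-- The total order on winners in which `left` is larger than `right`. -/
instance : LE Player := ⟨fun x y => x = .left → y = .left⟩

/-- A finite game form: finitely many Left options and finitely many Right options,
recursively. Every play is finite because the type is inductive. -/
inductive GameForm : Type
  | node (m n : ℕ) (leftOption : Fin m → GameForm) (rightOption : Fin n → GameForm) : GameForm

/-- An assignment of a winner to every split of the total budget `TB`: `ω h p` is the winner if
player `h` holds the marker, Left's budget is `p` and Right's budget is `TB - p`. -/
abbrev Outcome (TB : ℕ) : Type := Player → Fin (TB + 1) → Player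

/-- A bid of a player with the given budget: an amount of at most that budget, and, only if the
player holds the marker, possibly the marker as well. -/
structure Bid (budget : ℕ) (holdsMarker : Prop) where
  amount : ℕ
  amount_le : amount ≤ budget
  withMarker : Prop
  marker_held : withMarker → holdsMarker

/-- A bid of Left if `h` holds the marker and Left has budget `p`. -/
abbrev LeftBid {TB : ℕ} (h : Player) (p : Fin (TB + 1)) : Type :=
  Bid (p : ℕ) (h = .left)

/-- A bid of Right if `h` holds the marker and Left has budget `p`. -/
abbrev RightBid {TB : ℕ} (h : Player) (p : Fin (TB + 1)) : Type :=
  Bid (TB - (p : ℕ)) (h = .right)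

section Auction

variable {TB : ℕ} {h : Player} {p : Fin (TB + 1)}

/-- Left wins the auction if she bids strictly more, or if the bids tie and she holds the marker.
Otherwise Right wins the auction. -/
def LeftWinsAuction (x : LeftBid h p) (y : RightBid h p) : Prop :=
  y.amount < x.amount ∨ (x.amount = y.amount ∧ h = .left)

open Classical in
/-- The marker holder after Left has won the auction: a marker held by Left passes to Right if the
bids tie or Left included the marker in her bid. -/
noncomputable def holderAfterLeft (x : LeftBid h p) (y : RightBid h p) : Player :=
  if h = .left ∧ (x.amount = y.amount ∨ x.withMarker) then .right else h

open Classical in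
/-- The marker holder after Right has won the auction: a marker held by Right passes to Left if the
bids tie or Right included the marker in his bid. -/
noncomputable def holderAfterRight (x : LeftBid h p) (y : RightBid h p) : Player :=
  if h = .right ∧ (x.amount = y.amount ∨ y.withMarker) then .left else h

/-- Left's budget after she has paid her winning bid to Right. -/
def budgetAfterLeft (x : LeftBid h p) : Fin (TB + 1) :=
  ⟨(p : ℕ) - x.amount, by have := p.isLt; omega⟩

/-- Left's budget after Right has paid his winning bid to her. -/
def budgetAfterRight (y : RightBid h p) : Fin (TB + 1) :=
  ⟨(p : ℕ) + y.amount, by have := p.isLt; have := y.amount_le; omega⟩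

open Classical in
/-- The winner of the game after the bids `x` and `y`, if the outcomes of the Left options are `vL`
and those of the Right options are `vR`: the winner of the auction moves to an option that they
win, if there is one, and otherwise (in particular if they have no option at all) they lose. -/
noncomputable def winnerAfterBids {m n : ℕ} (vL : Fin m → Outcome TB) (vR : Fin n → Outcome TB)
    (x : LeftBid h p) (y : RightBid h p) : Player :=
  if LeftWinsAuction x y then
    if ∃ i, vL i (holderAfterLeft x y) (budgetAfterLeft x) = .left then .left else .right
  else
    if ∃ j, vR j (holderAfterRight x y) (budgetAfterRight y) = .right then .right else .left

/-- The pair of bids `(x, y)` is a pure equilibrium of the simultaneous bidding: no other bid of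
Left gives a result better for Left, and no other bid of Right a result better for Right. -/
def IsBidEquilibrium {m n : ℕ} (vL : Fin m → Outcome TB) (vR : Fin n → Outcome TB)
    (x : LeftBid h p) (y : RightBid h p) : Prop :=
  (∀ x' : LeftBid h p, winnerAfterBids vL vR x' y ≤ winnerAfterBids vL vR x y) ∧
  (∀ y' : RightBid h p, winnerAfterBids vL vR x y ≤ winnerAfterBids vL vR x y')

end Auction

/-- `HasOutcome TB G ω` says `o(G) = ω` for total budget `TB`: for every budget and marker split,
the game is won by the player that `ω` names in a pure strategy subgame perfect equilibrium.
Backward induction: the options have equilibrium outcomes, and, with these, for every split there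
is an equilibrium pair of bids in `G` after which that player wins. -/
def HasOutcome (TB : ℕ) : GameForm → Outcome TB → Prop
  | .node m n optL optR, ω =>
      ∃ (vL : Fin m → Outcome TB) (vR : Fin n → Outcome TB),
        (∀ i, HasOutcome TB (optL i) (vL i)) ∧ (∀ j, HasOutcome TB (optR j) (vR j)) ∧
        ∀ (h : Player) (p : Fin (TB + 1)), ∃ (x : LeftBid h p) (y : RightBid h p),
          IsBidEquilibrium vL vR x y ∧ winnerAfterBids vL vR x y = ω h p

/-- Monotonicity: with the same marker holder, one more dollar never hurts Left. -/
def IsMonotone {TB : ℕ} (ω : Outcome TB) : Prop :=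
  ∀ (h : Player) (p p' : Fin (TB + 1)), (p' : ℕ) = p + 1 → ω h p ≤ ω h p'

/-- Marker Worth: for Left, the marker is never worth more than a dollar. -/
def MarkerWorth {TB : ℕ} (ω : Outcome TB) : Prop :=
  ∀ p p' : Fin (TB + 1), (p' : ℕ) = p + 1 → ω .left p ≤ ω .right p'

/-- An outcome is feasible if it is monotone and satisfies Marker Worth. -/
def IsFeasible {TB : ℕ} (ω : Outcome TB) : Prop :=
  IsMonotone ω ∧ MarkerWorth ω

end BiddingGame

namespace BiddingGame

/-! A feasible outcome is a pair of thresholds `(α, β)`, the least budgets with which Left wins with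
and without the marker; Marker Worth becomes `β ≤ α + 1` (`isFeasible_iff`). At a node only two
numbers matter: `a`, the budget from which Left can move to a win after handing over the marker, and
`b`, the budget from which every Right move loses after Right hands it over. Marker Worth of the
options says that keeping the marker gains a mover at most one dollar, so explicit bids force
thresholds `max a ⌊(a+b)/2⌋` and `min b ⌈(a+b)/2⌉`. These are again feasible, and induction gives
existence and feasibility. Conversely, bisection between `(0, 0)` and `(TB+1, TB+1)` realizes every
diagonal pair, and a node with options `(α, α)` and `(β, β)` realizes `(α, β)`. -/

theorem Player.le_iff (x y : Player) : x ≤ y ↔ (x = .left → y = .left) := Iff.rfl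

theorem Player.ne_left_iff {x : Player} : x ≠ .left ↔ x = .right := by
  cases x <;> simp

theorem Player.eq_of_le_of_le {x y : Player} (h : x ≤ y) (h' : y ≤ x) : x = y := by
  cases x <;> cases y <;> simp_all [Player.le_iff]

/-! ### Feasible outcomes as pairs of thresholds. -/

/-- The outcome in which Left wins with the marker from budget `α` on, and without the marker from
budget `β` on. -/
def thresholdOutcome (TB α β : ℕ) : Outcome TB
  | .left, p => if α ≤ (p : ℕ) then .left else .right
  | .right, p => if β ≤ (p : ℕ) then .left else .right

theorem thresholdOutcome_left_eq {TB α β : ℕ} {p : Fin (TB + 1)} :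
    thresholdOutcome TB α β .left p = .left ↔ α ≤ (p : ℕ) := by
  simp only [thresholdOutcome]; split_ifs <;> simp_all

theorem thresholdOutcome_right_eq {TB α β : ℕ} {p : Fin (TB + 1)} :
    thresholdOutcome TB α β .right p = .left ↔ β ≤ (p : ℕ) := by
  simp only [thresholdOutcome]; split_ifs <;> simp_all

/-- A predicate on `Fin (TB + 1)` that is closed upwards is given by a threshold. -/
theorem exists_threshold {TB : ℕ} (P : Fin (TB + 1) → Prop)
    (hP : ∀ p p' : Fin (TB + 1), (p' : ℕ) = p + 1 → P p → P p') :
    ∃ a ≤ TB + 1, ∀ p : Fin (TB + 1), P p ↔ a ≤ (p : ℕ) := by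
  classical
  have hex : ∃ k, ∀ h : k < TB + 1, P ⟨k, h⟩ := ⟨TB + 1, fun h => absurd h (lt_irrefl _)⟩
  refine ⟨Nat.find hex, Nat.find_min' hex fun h => absurd h (lt_irrefl _), fun p => ⟨fun h =>
    Nat.find_min' hex fun _ => h, fun h => ?_⟩⟩
  have key : ∀ k, Nat.find hex ≤ k → ∀ hk : k < TB + 1, P ⟨k, hk⟩ := by
    intro k h
    induction k, h using Nat.le_induction with
    | base => exact Nat.find_spec hex
    | succ n hn ih => exact fun hk => hP ⟨n, by omega⟩ _ rfl (ih (by omega))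
  exact key p h p.isLt

theorem isFeasible_iff {TB : ℕ} (ω : Outcome TB) :
    IsFeasible ω ↔ ∃ α β, α ≤ TB + 1 ∧ β ≤ TB + 1 ∧ β ≤ α + 1 ∧ ω = thresholdOutcome TB α β := by
  constructor
  · rintro ⟨hm, hw⟩
    obtain ⟨α, hα, h₁⟩ := exists_threshold (fun p => ω .left p = .left) (hm .left)
    obtain ⟨β, hβ, h₂⟩ := exists_threshold (fun p => ω .right p = .left) (hm .right)
    refine ⟨α, β, hα, hβ, ?_, ?_⟩
    -- For `α ≥ TB` the bound is automatic, since `β ≤ TB + 1`.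
    · by_cases h : α < TB
      · exact (h₂ ⟨α + 1, by omega⟩).1
          (hw ⟨α, by omega⟩ ⟨α + 1, by omega⟩ rfl ((h₁ ⟨α, by omega⟩).2 le_rfl))
      · omega
    · funext h p
      cases h
      · exact Player.eq_of_le_of_le (fun h => thresholdOutcome_left_eq.2 ((h₁ p).1 h))
          fun h => (h₁ p).2 (thresholdOutcome_left_eq.1 h)
      · exact Player.eq_of_le_of_le (fun h => thresholdOutcome_right_eq.2 ((h₂ p).1 h))
          fun h => (h₂ p).2 (thresholdOutcome_right_eq.1 h)
  · rintro ⟨α, β, -, -, h, rfl⟩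
    refine ⟨fun h p p' hp => ?_, fun p p' hp => ?_⟩
    · cases h <;>
        simp only [Player.le_iff, thresholdOutcome_left_eq, thresholdOutcome_right_eq] <;> omega
    · simp only [Player.le_iff, thresholdOutcome_left_eq, thresholdOutcome_right_eq]
      omega

/-! ### Solving one round of bidding. -/

section Auction

variable {TB : ℕ} {h : Player} {p : Fin (TB + 1)} {m n : ℕ} {vL : Fin m → Outcome TB}
  {vR : Fin n → Outcome TB}

/-- The value of the simultaneous bidding is the same in all equilibria. -/
theorem IsBidEquilibrium.winner_eq {x x' : LeftBid h p} {y y' : RightBid h p}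
    (e : IsBidEquilibrium vL vR x y) (e' : IsBidEquilibrium vL vR x' y') :
    winnerAfterBids vL vR x y = winnerAfterBids vL vR x' y' :=
  -- Saddle points of a zero-sum game: compare both values with those at the mixed pairs `(x, y')`
  -- and `(x', y)`.
  Player.eq_of_le_of_le (fun w => e'.1 x (e.2 y' w)) fun w => e.1 x' (e'.2 y w)

theorem winnerAfterBids_eq_left_iff (x : LeftBid h p) (y : RightBid h p) :
    winnerAfterBids vL vR x y = .left ↔
      (LeftWinsAuction x y → ∃ i, vL i (holderAfterLeft x y) (budgetAfterLeft x) = .left) ∧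
      (¬ LeftWinsAuction x y →
        ∀ j, vR j (holderAfterRight x y) (budgetAfterRight y) = .left) := by
  unfold winnerAfterBids
  split_ifs with h₁ h₂ h₃
  · simp [h₁, h₂]
  · simp [h₁, h₂]
  · obtain ⟨j, hj⟩ := h₃
    simp only [h₁, not_false_eq_true, true_imp_iff, false_imp_iff, true_and,
      false_iff, not_forall]
    exact ⟨j, by simp [hj]⟩
  · simp only [h₁, not_false_eq_true, true_imp_iff, false_imp_iff, true_and, true_iff]
    exact fun j => by_contra fun h => h₃ ⟨j, Player.ne_left_iff.1 h⟩

theorem exists_equilibrium_of_guarantee_left (x : LeftBid h p)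
    (hx : ∀ y : RightBid h p, winnerAfterBids vL vR x y = .left) :
    ∃ (x : LeftBid h p) (y : RightBid h p),
      IsBidEquilibrium vL vR x y ∧ winnerAfterBids vL vR x y = .left :=
  ⟨x, ⟨0, Nat.zero_le _, False, False.elim⟩, ⟨fun _ _ => hx _, fun _ _ => hx _⟩, hx _⟩

theorem exists_equilibrium_of_guarantee_right (y : RightBid h p)
    (hy : ∀ x : LeftBid h p, winnerAfterBids vL vR x y ≠ .left) :
    ∃ (x : LeftBid h p) (y : RightBid h p),
      IsBidEquilibrium vL vR x y ∧ winnerAfterBids vL vR x y = .right :=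
  ⟨⟨0, Nat.zero_le _, False, False.elim⟩, y, ⟨fun _ h => absurd h (hy _),
    fun _ h => absurd h (hy _)⟩, Player.ne_left_iff.1 (hy _)⟩

/-- `a` and `b` describe the options well enough to solve the bidding: Left has a winning option at
which Right holds the marker from budget `a` on, Right has no winning option at which Left holds
the marker from budget `b` on, and the marker is never worth more than a dollar. -/
structure OptionThresholds (vL : Fin m → Outcome TB) (vR : Fin n → Outcome TB) (a b : ℕ) :
    Prop where
  a_le : a ≤ TB + 1
  b_le : b ≤ TB + 1
  left_iff (p : Fin (TB + 1)) : (∃ i, vL i .right p = .left) ↔ a ≤ (p : ℕ)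
  left_marker (p : Fin (TB + 1)) : (∃ i, vL i .left p = .left) → a ≤ (p : ℕ) + 1
  right_iff (p : Fin (TB + 1)) : (∀ j, vR j .left p = .left) ↔ b ≤ (p : ℕ)
  right_marker (p : Fin (TB + 1)) : b + 1 ≤ (p : ℕ) → ∀ j, vR j .right p = .left

variable {a b : ℕ}

theorem OptionThresholds.exists_equilibrium_left (H : OptionThresholds vL vR a b)
    (p : Fin (TB + 1)) :
    ∃ (x : LeftBid .left p) (y : RightBid .left p), IsBidEquilibrium vL vR x y ∧
      winnerAfterBids vL vR x y
        = if max a ((a + b) / 2) ≤ (p : ℕ) then Player.left else .right := by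
  have ha := H.a_le
  have hb := H.b_le
  have hp := p.isLt
  split_ifs with hc
  -- Winning leaves Left at least `a`. To outbid, Right must pay at least `p - a + 1`, and `2 * p +
  -- 1 ≥ a + b` lifts Left to `b`.
  · refine exists_equilibrium_of_guarantee_left
      ⟨min (p - a) (TB - p), by omega, True, fun _ => rfl⟩ fun y => ?_
    have hy := y.amount_le
    rw [winnerAfterBids_eq_left_iff]
    refine ⟨fun hw => ?_, fun hw => ?_⟩
    · simp only [holderAfterLeft, or_true, and_self, if_true]
      rw [H.left_iff]
      simp only [budgetAfterLeft]
      omega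
    · simp only [LeftWinsAuction, and_true] at hw
      simp only [holderAfterRight, reduceCtorEq, false_and, if_false]
      rw [H.right_iff]
      simp only [budgetAfterRight]
      omega
  -- A Left win leaves her below `a`; keeping the marker requires a strictly higher bid, costing the
  -- dollar that `left_marker` allows. A Right win leaves Left at `2 * p + 1 - a < b`.
  · refine exists_equilibrium_of_guarantee_right
      ⟨p + 1 - a, by omega, False, False.elim⟩ fun x => ?_
    have hx := x.amount_le
    rw [Ne, winnerAfterBids_eq_left_iff]
    rintro ⟨h₁, h₂⟩
    by_cases hw : LeftWinsAuction (h := .left) (p := p) x ⟨p + 1 - a, by omega, False, False.elim⟩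
    · replace h₁ := h₁ hw
      simp only [LeftWinsAuction, and_true] at hw
      unfold holderAfterLeft at h₁
      split_ifs at h₁ with hm
      · rw [H.left_iff] at h₁
        simp only [budgetAfterLeft] at h₁
        omega
      · replace h₁ := H.left_marker _ h₁
        simp only [budgetAfterLeft] at h₁
        simp only [true_and, not_or] at hm
        omega
    · replace h₂ := h₂ hw
      simp only [LeftWinsAuction, and_true] at hw
      simp only [holderAfterRight, reduceCtorEq, false_and, if_false] at h₂
      rw [H.right_iff] at h₂
      simp only [budgetAfterRight] at h₂
      omega

theorem OptionThresholds.exists_equilibrium_right (H : OptionThresholds vL vR a b)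
    (p : Fin (TB + 1)) :
    ∃ (x : LeftBid .right p) (y : RightBid .right p), IsBidEquilibrium vL vR x y ∧
      winnerAfterBids vL vR x y
        = if min b ((a + b + 1) / 2) ≤ (p : ℕ) then Player.left else .right := by
  have ha := H.a_le
  have hb := H.b_le
  have hp := p.isLt
  split_ifs with hc
  -- The least bid for which a winning Right lifts Left to `b`; if he keeps the marker he must bid
  -- one more, as `right_marker` needs.
  · refine exists_equilibrium_of_guarantee_left
      ⟨b - p, by omega, False, False.elim⟩ fun y => ?_
    have hy := y.amount_le
    rw [winnerAfterBids_eq_left_iff]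
    refine ⟨fun hw => ?_, fun hw => ?_⟩
    · simp only [LeftWinsAuction, reduceCtorEq, and_false, or_false] at hw
      simp only [holderAfterLeft, reduceCtorEq, false_and, if_false]
      rw [H.left_iff]
      simp only [budgetAfterLeft]
      omega
    · simp only [LeftWinsAuction, reduceCtorEq, and_false, or_false] at hw
      unfold holderAfterRight
      split_ifs with hm
      · rw [H.right_iff]
        simp only [budgetAfterRight]
        omega
      · refine H.right_marker _ ?_
        simp only [true_and, not_or] at hm
        simp only [budgetAfterRight]
        omega
  -- The largest bid that keeps Left below `b`; beating it costs Left at least `b - p`, leaving her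
  -- below `a`.
  · refine exists_equilibrium_of_guarantee_right
      ⟨b - 1 - p, by omega, True, fun _ => rfl⟩ fun x => ?_
    have hx := x.amount_le
    rw [Ne, winnerAfterBids_eq_left_iff]
    rintro ⟨h₁, h₂⟩
    by_cases hw : LeftWinsAuction (h := .right) (p := p) x
        ⟨b - 1 - p, by omega, True, fun _ => rfl⟩
    · replace h₁ := h₁ hw
      simp only [LeftWinsAuction, reduceCtorEq, and_false, or_false] at hw
      simp only [holderAfterLeft, reduceCtorEq, false_and, if_false] at h₁
      rw [H.left_iff] at h₁
      simp only [budgetAfterLeft] at h₁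
      omega
    · replace h₂ := h₂ hw
      simp only [LeftWinsAuction, reduceCtorEq, and_false, or_false] at hw
      simp only [holderAfterRight, or_true, and_self, if_true] at h₂
      rw [H.right_iff] at h₂
      simp only [budgetAfterRight] at h₂
      omega

theorem OptionThresholds.hasOutcome (H : OptionThresholds vL vR a b)
    {optL : Fin m → GameForm} {optR : Fin n → GameForm}
    (hL : ∀ i, HasOutcome TB (optL i) (vL i)) (hR : ∀ j, HasOutcome TB (optR j) (vR j)) :
    HasOutcome TB (.node m n optL optR)
      (thresholdOutcome TB (max a ((a + b) / 2)) (min b ((a + b + 1) / 2))) := by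
  refine ⟨vL, vR, hL, hR, fun h p => ?_⟩
  cases h
  · exact H.exists_equilibrium_left p
  · exact H.exists_equilibrium_right p

/-- Monotonicity gives `a` and `b`; Marker Worth gives the two marker clauses. This is why
feasibility is carried through the induction. -/
theorem exists_optionThresholds (hL : ∀ i, IsFeasible (vL i)) (hR : ∀ j, IsFeasible (vR j)) :
    ∃ a b, OptionThresholds vL vR a b := by
  obtain ⟨a, ha, h₁⟩ := exists_threshold (fun p => ∃ i, vL i .right p = .left)
    fun p p' hp ⟨i, hi⟩ => ⟨i, (hL i).1 .right p p' hp hi⟩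
  obtain ⟨b, hb, h₂⟩ := exists_threshold (fun p => ∀ j, vR j .left p = .left)
    fun p p' hp h j => (hR j).1 .left p p' hp (h j)
  refine ⟨a, b, ha, hb, h₁, fun p ⟨i, hi⟩ => ?_, h₂, fun p hp j => ?_⟩
  · by_cases h : (p : ℕ) < TB
    · exact (h₁ ⟨p + 1, by omega⟩).1 ⟨i, (hL i).2 p ⟨p + 1, by omega⟩ rfl hi⟩
    · omega
  · have := p.isLt
    refine (hR j).2 ⟨p - 1, by omega⟩ p (by simp only; omega) ((h₂ _).2 ?_ j)
    simp only
    omega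

end Auction

/-! ### Existence, uniqueness and feasibility of outcomes. -/

theorem HasOutcome.unique {TB : ℕ} {G : GameForm} {ω ω' : Outcome TB} (hω : HasOutcome TB G ω)
    (hω' : HasOutcome TB G ω') : ω = ω' := by
  induction G generalizing ω ω' with
  | node m n optL optR ihL ihR =>
    obtain ⟨vL, vR, hL, hR, h⟩ := hω
    obtain ⟨vL', vR', hL', hR', h'⟩ := hω'
    obtain rfl : vL = vL' := funext fun i => ihL i (hL i) (hL' i)
    obtain rfl : vR = vR' := funext fun j => ihR j (hR j) (hR' j)
    funext k p
    obtain ⟨x, y, e, hw⟩ := h k p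
    obtain ⟨x', y', e', hw'⟩ := h' k p
    rw [← hw, ← hw', e.winner_eq e']

theorem exists_feasible_hasOutcome (TB : ℕ) (G : GameForm) :
    ∃ ω : Outcome TB, IsFeasible ω ∧ HasOutcome TB G ω := by
  induction G with
  | node m n optL optR ihL ihR =>
    choose vL fL hL using ihL
    choose vR fR hR using ihR
    obtain ⟨a, b, H⟩ := exists_optionThresholds fL fR
    have ha := H.a_le
    have hb := H.b_le
    exact ⟨_, (isFeasible_iff _).2 ⟨_, _, by omega, by omega, by omega, rfl⟩, H.hasOutcome hL hR⟩

/-! ### Realizing every feasible pair of thresholds. -/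

/-- Some game form has the outcome with thresholds `α` and `β`. -/
def IsRealized (TB α β : ℕ) : Prop :=
  ∃ G : GameForm, HasOutcome TB G (thresholdOutcome TB α β)

section Construction

variable {TB α β a b : ℕ}

theorem OptionThresholds.isRealized {m n : ℕ} {vL : Fin m → Outcome TB} {vR : Fin n → Outcome TB}
    (H : OptionThresholds vL vR a b) {optL : Fin m → GameForm} {optR : Fin n → GameForm}
    (hL : ∀ i, HasOutcome TB (optL i) (vL i)) (hR : ∀ j, HasOutcome TB (optR j) (vR j))
    (hα : max a ((a + b) / 2) = α) (hβ : min b ((a + b + 1) / 2) = β) : IsRealized TB α β :=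
  hα ▸ hβ ▸ ⟨_, H.hasOutcome hL hR⟩

theorem isRealized_empty (TB : ℕ) : IsRealized TB (TB + 1) 0 := by
  have H : OptionThresholds (TB := TB) (m := 0) (n := 0) Fin.elim0 Fin.elim0 (TB + 1) 0 := by
    refine ⟨le_rfl, Nat.zero_le _, fun p => ?_, fun p => ?_, fun p => ?_, fun p _ j => j.elim0⟩
    all_goals simp
    omega
  exact H.isRealized (optL := Fin.elim0) (optR := Fin.elim0) (fun i => i.elim0)
    (fun j => j.elim0) (by omega) (by omega)

/-- If only Left has an option, and it is the empty game form, then Left always wins. -/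
theorem isRealized_zero (TB : ℕ) : IsRealized TB 0 0 := by
  obtain ⟨G, hG⟩ := isRealized_empty TB
  have H : OptionThresholds (TB := TB) (m := 1) (n := 0)
      (fun _ => thresholdOutcome TB (TB + 1) 0) Fin.elim0 0 0 := by
    refine ⟨Nat.zero_le _, Nat.zero_le _, fun p => ?_, fun p => ?_, fun p => ?_,
      fun p _ j => j.elim0⟩ <;> simp [thresholdOutcome_right_eq]
  exact H.isRealized (optL := fun _ => G) (optR := Fin.elim0) (fun _ => hG)
    (fun j => j.elim0) (by omega) (by omega)

/-- If only Right has an option, and it is the empty game form, then Right always wins. -/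
theorem isRealized_top (TB : ℕ) : IsRealized TB (TB + 1) (TB + 1) := by
  obtain ⟨G, hG⟩ := isRealized_empty TB
  have H : OptionThresholds (TB := TB) (m := 0) (n := 1)
      Fin.elim0 (fun _ => thresholdOutcome TB (TB + 1) 0) (TB + 1) (TB + 1) := by
    refine ⟨le_rfl, le_rfl, fun p => ?_, fun p => ?_, fun p => ?_, fun p => ?_⟩ <;>
      simp [thresholdOutcome_left_eq, thresholdOutcome_right_eq]
    omega
  exact H.isRealized (optL := Fin.elim0) (optR := fun _ => G) (fun i => i.elim0)
    (fun _ => hG) (by omega) (by omega)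

/-- A game form with one Left option and one Right option. -/
theorem IsRealized.node (hL : IsRealized TB α a) (hR : IsRealized TB b β) (ha : a ≤ TB + 1)
    (hb : b ≤ TB + 1) (hα : a ≤ α + 1) (hβ : β ≤ b + 1) :
    IsRealized TB (max a ((a + b) / 2)) (min b ((a + b + 1) / 2)) := by
  obtain ⟨G, hG⟩ := hL
  obtain ⟨G', hG'⟩ := hR
  have H : OptionThresholds (m := 1) (n := 1) (fun _ => thresholdOutcome TB α a)
      (fun _ => thresholdOutcome TB b β) a b := by
    refine ⟨ha, hb, fun p => ?_, fun p => ?_, fun p => ?_, fun p => ?_⟩ <;>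
      simp only [thresholdOutcome_left_eq, thresholdOutcome_right_eq, exists_const,
        forall_const, iff_self] <;> omega
  exact ⟨_, H.hasOutcome (optL := fun _ => G) (optR := fun _ => G') (fun _ => hG) fun _ => hG'⟩

theorem IsRealized.of_le (hL : IsRealized TB a a) (hR : IsRealized TB b b) (ha : a ≤ TB + 1)
    (hb : b ≤ TB + 1) (hba : b ≤ a + 1) : IsRealized TB a b := by
  have h := hL.node hR ha hb (by omega) (by omega)
  rwa [show max a ((a + b) / 2) = a by omega, show min b ((a + b + 1) / 2) = b by omega] at h

/-- Discards `β`: a Left option where Right always wins yields `(TB+1, b)`, and using that as the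
Left option against `(b, β)` yields `(b, b)`. -/
theorem IsRealized.diagonal (h : IsRealized TB b β) (hb : b ≤ TB + 1) (hβ : β ≤ b + 1) :
    IsRealized TB b b := by
  have h₁ := (isRealized_top TB).node h le_rfl hb (by omega) hβ
  rw [show min b ((TB + 1 + b + 1) / 2) = b by omega] at h₁
  have h₂ := h₁.node h hb hb (by omega) hβ
  rwa [show max b ((b + b) / 2) = b by omega, show min b ((b + b + 1) / 2) = b by omega] at h₂

theorem IsRealized.midpoint (hL : IsRealized TB a a) (hR : IsRealized TB b b) (hab : a ≤ b)
    (hb : b ≤ TB + 1) : IsRealized TB ((a + b) / 2) ((a + b) / 2) := by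
  have h := hL.node hR (by omega) hb (by omega) (by omega)
  rw [show max a ((a + b) / 2) = (a + b) / 2 by omega] at h
  exact h.diagonal (by omega) (by omega)

/-- Bisection: rounding down stalls only when `b ≤ a + 1`, and then `x` is an endpoint. -/
theorem IsRealized.between (hL : IsRealized TB a a) (hR : IsRealized TB b b) (hb : b ≤ TB + 1)
    {x : ℕ} (hax : a ≤ x) (hxb : x ≤ b) : IsRealized TB x x := by
  induction hd : b - a using Nat.strong_induction_on generalizing a b with
  | _ d ih =>
    obtain rfl | hax' := hax.eq_or_lt
    · exact hL
    obtain rfl | hxb' := hxb.eq_or_lt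
    · exact hR
    have hm := hL.midpoint hR (by omega) hb
    rcases le_total x ((a + b) / 2) with h | h
    · exact ih _ (by omega) hL hm (by omega) hax h rfl
    · exact ih _ (by omega) hm hR hb h hxb rfl

theorem isRealized_of_le (hα : α ≤ TB + 1) (hβ : β ≤ TB + 1) (h : β ≤ α + 1) :
    IsRealized TB α β :=
  .of_le ((isRealized_zero TB).between (isRealized_top TB) le_rfl (Nat.zero_le _) hα)
    ((isRealized_zero TB).between (isRealized_top TB) le_rfl (Nat.zero_le _) hβ) hα hβ h

end Construction

end BiddingGame

theorem mainTheorem1 (TB : ℕ) :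
    (∀ G : BiddingGame.GameForm, ∃! ω : BiddingGame.Outcome TB, BiddingGame.HasOutcome TB G ω) ∧
    ∀ ω : BiddingGame.Outcome TB,
      BiddingGame.IsFeasible ω ↔ ∃ G : BiddingGame.GameForm, BiddingGame.HasOutcome TB G ω := by
  refine ⟨fun G => ?_, fun ω => ⟨fun h => ?_, fun ⟨G, hG⟩ => ?_⟩⟩
  · obtain ⟨ω, -, hω⟩ := BiddingGame.exists_feasible_hasOutcome TB G
    exact ⟨ω, hω, fun ω' hω' => hω'.unique hω⟩
  · obtain ⟨α, β, hα, hβ, hβα, rfl⟩ := (BiddingGame.isFeasible_iff ω).1 h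
    exact BiddingGame.isRealized_of_le hα hβ hβα
  · obtain ⟨ω', hf, hω'⟩ := BiddingGame.exists_feasible_hasOutcome TB G
    rwa [hG.unique hω']
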